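/- Let $p$ be a prime, $k=\overline{\mathbb F}_p$, $G$ a finite group and $B$ a block of $kG$, i.e. $B=kG\,e_B$ for a primitive idempotent $e_B$ of the centre $Z(kG)$. The Cartan matrix of $B$ has rows and columns indexed by the isomorphism classes of simple $B$-modules, its entry at $(S,T)$ being the multiplicity of $T$ as a composition factor of the projective cover of $S$. Write $\mathrm{c}(B)$ for the largest entry of the Cartan matrix of $B$. (i) Let $N\lhd G$ have index $p^r$ and suppose that $B$ covers a block $b$ of $kN$ (i.e. $e_Be_b\neq 0$). Then $\mathrm{c}(B)\le p^r\,\mathrm{c}(b)$. (ii) Let $Z\le Z(G)$ be a $2$-group, and let $\overline B$ be the block of $k(G/Z)$ corresponding to $B$, i.e. the block with $\overline{e_B}\,e_{\overline B}=e_{\overline B}$, where $\overline{e_B}$ is the image of $e_B$ under the natural homomorphism $kG\to k(G/Z)$. Then $\mathrm{c}(\overline B)\le \mathrm{c}(B)$. (For $p=2$ such a block $\overline B$ exists and is unique; for odd $p$ the assertion is made for every block $\overline B$ of $k(G/Z)$ with this property.) -/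

import Mathlib

universe u

section Modules

variable {A : Type u} [Ring A]

/-- `π : P → M` is a projective cover of `M`: the module `P` is projective, `π` is surjective and
`ker π` is superfluous, i.e. the only submodule `U` of `P` with `U + ker π = P` is `P` itself. -/
structure IsProjectiveCover {P M : Type u} [AddCommGroup P] [Module A P] [AddCommGroup M]
    [Module A M] (π : P →ₗ[A] M) : Prop where
  projective : Module.Projective A P
  surjective : Function.Surjective π
  superfluous : ∀ U : Submodule A P, U ⊔ LinearMap.ker π = ⊤ → U = ⊤

open Classical in
/-- The number of factors `Mᵢ₊₁ / Mᵢ` of a composition series `M₀ ⋖ M₁ ⋖ ⋯` of submodules of `M`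
which are isomorphic to `T`. -/
noncomputable def factorCount {M : Type u} [AddCommGroup M] [Module A M]
    (s : CompositionSeries (Submodule A M)) (T : Type u) [AddCommGroup T] [Module A T] : ℕ :=
  (Finset.univ.filter fun i : Fin s.length =>
    Nonempty ((s i.succ ⧸ (s i.castSucc).submoduleOf (s i.succ)) ≃ₗ[A] T)).card

/-- `n` is the multiplicity of `T` as a composition factor of `M`, i.e. the number of factors
isomorphic to `T` in a composition series running from `0` to `M`.
By the Jordan–Hölder theorem it does not matter which one. -/
def IsCompositionMultiplicity (M T : Type u) [AddCommGroup M] [Module A M]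
    [AddCommGroup T] [Module A T] (n : ℕ) : Prop :=
  ∃ s : CompositionSeries (Submodule A M), s.head = ⊥ ∧ s.last = ⊤ ∧ n = factorCount s T

/-- `e` is a block idempotent of `A`, i.e. a primitive idempotent of the centre of `A`.
The corresponding block is the ideal (and algebra with identity element `e`) `A e`. -/
structure IsBlockIdempotent (e : A) : Prop where
  mem_center : e ∈ Subring.center A
  idempotent : IsIdempotentElem e
  ne_zero : e ≠ 0
  primitive : ∀ f ∈ Subring.center A, IsIdempotentElem f → f * e = f → f = 0 ∨ f = e

/-- The `A`-module `M` belongs to the block `A e`, i.e. `e` acts on `M` as the identity.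
These are exactly the modules over the algebra `A e`. -/
def BelongsToBlock (e : A) (M : Type u) [AddCommGroup M] [Module A M] : Prop :=
  ∀ x : M, e • x = x

/-- The set of all entries of the Cartan matrix of the block `A e`: for simple modules `S` and `T`
of the block, the entry at `(S, T)` is the multiplicity of `T` as a composition factor of the
projective cover `P` of `S`. -/
def cartanEntries (e : A) : Set ℕ :=
  {n | ∃ (S : Type u) (_ : AddCommGroup S) (_ : Module A S)
        (T : Type u) (_ : AddCommGroup T) (_ : Module A T)
        (P : Type u) (_ : AddCommGroup P) (_ : Module A P) (π : P →ₗ[A] S),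
      IsSimpleModule A S ∧ BelongsToBlock e S ∧ IsSimpleModule A T ∧ BelongsToBlock e T ∧
      IsProjectiveCover π ∧ IsCompositionMultiplicity (A := A) P T n}

/-- `c(B)`: the largest entry of the Cartan matrix of the block `B = A e`
(see `isGreatest_largestCartan`). -/
noncomputable def largestCartan (e : A) : ℕ := sSup (cartanEntries e)

end Modules

section LargestEntry

variable {A : Type u} [Ring A]

/-- A simple module over an artinian ring has a projective cover. -/
theorem exists_isProjectiveCover [IsArtinianRing A] (S : Type u) [AddCommGroup S] [Module A S]
    [IsSimpleModule A S] :
    ∃ (P : Type u) (_ : AddCommGroup P) (_ : Module A P) (π : P →ₗ[A] S), IsProjectiveCover π := by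
  let X : Set (Submodule A A) :=
    {U | Module.Projective A U ∧ ∃ π : U →ₗ[A] S, Function.Surjective π}
  have hX : X.Nonempty := by
    have := IsSimpleModule.nontrivial A S
    obtain ⟨x, hx⟩ := exists_ne (0 : S)
    refine ⟨⊤, Module.Projective.of_equiv (Submodule.topEquiv (R := A) (M := A)).symm,
      (LinearMap.toSpanSingleton A S x).comp (Submodule.topEquiv (R := A) (M := A)).toLinearMap, ?_⟩
    exact (IsSimpleModule.toSpanSingleton_surjective A hx).comp
      (Submodule.topEquiv (R := A) (M := A)).surjective
  obtain ⟨U, ⟨hUp, π, hπ⟩, hmin⟩ := wellFounded_lt.has_min X hX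
  refine ⟨U, inferInstance, inferInstance, π, hUp, hπ, fun W hW => ?_⟩
  have hsurj : Function.Surjective (π.comp W.subtype) := by
    rw [← LinearMap.range_eq_top, LinearMap.range_comp, Submodule.range_subtype,
      eq_top_iff, ← LinearMap.range_eq_top.2 hπ, LinearMap.range_eq_map, ← hW, Submodule.map_sup]
    simp [(LinearMap.le_ker_iff_map (f := π)).1 le_rfl]
  obtain ⟨φ, hφ⟩ := Module.projective_lifting_property (π.comp W.subtype) π hsurj
  let ψ : Module.End A U := W.subtype.comp φ
  have hψ : ∀ x, π (ψ x) = π x := fun x => by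
    simpa [ψ] using LinearMap.congr_fun hφ x
  have hψn : ∀ n x, π ((ψ ^ n) x) = π x := by
    intro n
    induction n with
    | zero => intro x; simp
    | succ n ih => intro x; rw [pow_succ', Module.End.mul_apply, hψ, ih]
  obtain ⟨n, hcompl, hn⟩ :=
    ((ψ.eventually_isCompl_ker_pow_range_pow).and (Filter.eventually_ge_atTop 1)).exists
  let R : Submodule A U := LinearMap.range (ψ ^ n)
  let eR : R ≃ₗ[A] R.map U.subtype := R.equivMapOfInjective _ U.injective_subtype
  have hRp : Module.Projective A R :=
    Module.Projective.of_split R.subtype (R.projectionOnto (LinearMap.ker (ψ ^ n)) hcompl.symm)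
      (by ext x; simp)
  have hmem : R.map U.subtype ∈ X := by
    refine ⟨Module.Projective.of_equiv eR, (π.comp R.subtype).comp eR.symm.toLinearMap, ?_⟩
    refine Function.Surjective.comp (g := π.comp R.subtype) (fun s => ?_) eR.symm.surjective
    obtain ⟨x, rfl⟩ := hπ s
    exact ⟨⟨(ψ ^ n) x, x, rfl⟩, hψn n x⟩
  have hle : R.map U.subtype ≤ U := Submodule.map_subtype_le U R
  have heq : R.map U.subtype = U := by
    by_contra hne
    exact hmin _ hmem (lt_of_le_of_ne hle hne)
  rw [eq_top_iff]
  intro x _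
  have hx : (x : A) ∈ R.map U.subtype := by rw [heq]; exact x.2
  obtain ⟨y, ⟨z, hz⟩, hyx⟩ := hx
  have hyx' : y = x := Subtype.ext hyx
  obtain ⟨m, rfl⟩ := Nat.exists_eq_add_of_le' hn
  rw [← hyx', ← hz, pow_succ', Module.End.mul_apply]
  exact (φ ((ψ ^ m) z)).2

/-- A projective cover of a simple module is cyclic. -/
theorem IsProjectiveCover.exists_generator {P S : Type u} [AddCommGroup P] [Module A P]
    [AddCommGroup S] [Module A S] [IsSimpleModule A S] {π : P →ₗ[A] S}
    (hπ : IsProjectiveCover π) :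
    ∃ y : P, LinearMap.range (LinearMap.toSpanSingleton A P y) = ⊤ := by
  have := IsSimpleModule.nontrivial A S
  obtain ⟨x, hx⟩ := exists_ne (0 : S)
  obtain ⟨y, rfl⟩ := hπ.surjective x
  refine ⟨y, ?_⟩
  apply hπ.superfluous
  rw [eq_top_iff]
  intro z _
  obtain ⟨a, ha⟩ := IsSimpleModule.toSpanSingleton_surjective A hx (π z)
  refine Submodule.mem_sup.2 ⟨a • y, ⟨a, rfl⟩, z - a • y, ?_, by abel⟩
  simp only [LinearMap.toSpanSingleton_apply] at ha
  simp [ha]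

/-- The set of Cartan invariants of a block of an artinian ring has a largest element, and this is
`largestCartan`. -/
theorem isGreatest_largestCartan [IsArtinianRing A] {e : A} (he : IsBlockIdempotent e) :
    IsGreatest (cartanEntries e) (largestCartan e) := by
  have hbdd : BddAbove (cartanEntries e) := by
    refine ⟨(Module.length A A).toNat, ?_⟩
    rintro n ⟨S, _, _, T, _, _, P, _, _, π, hS, -, -, -, hπ, s, h0, h1, rfl⟩
    obtain ⟨y, hy⟩ := hπ.exists_generator
    have hlen := Module.length_le_of_surjective _ (LinearMap.range_eq_top.1 hy)
    rw [← Module.length_compositionSeries s h0 h1] at hlen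
    have hcard : factorCount s T ≤ s.length := by
      classical
      unfold factorCount
      exact (Finset.card_filter_le _ _).trans (by simp)
    exact hcard.trans (by
      simpa using ENat.toNat_le_toNat hlen (Module.length_ne_top (R := A) (M := A)))
  have hne : (cartanEntries e).Nonempty := by
    let J : Submodule A A := Submodule.span A {e}
    have heJ : e ∈ J := Submodule.mem_span_singleton_self e
    have : Nontrivial J := ⟨⟨⟨e, heJ⟩, 0, fun h => he.ne_zero (congrArg Subtype.val h)⟩⟩
    obtain ⟨m, hm, -⟩ := (eq_top_or_exists_le_coatom (⊥ : Submodule A J)).resolve_left bot_ne_top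
    have hS : IsSimpleModule A (J ⧸ m) := isSimpleModule_iff_isCoatom.2 hm
    have hSe : BelongsToBlock e (J ⧸ m) := by
      intro x
      obtain ⟨⟨x, hx⟩, rfl⟩ := Submodule.mkQ_surjective m x
      obtain ⟨a, rfl⟩ := Submodule.mem_span_singleton.1 hx
      rw [← map_smul]
      congr 1
      apply Subtype.ext
      change e * (a * e) = a * e
      rw [← Subring.mem_center_iff.1 he.mem_center, mul_assoc, he.idempotent.eq]
    obtain ⟨P, _, _, π, hπ⟩ := exists_isProjectiveCover (A := A) (J ⧸ m)
    obtain ⟨y, hy⟩ := hπ.exists_generator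
    have hfin : Module.Finite A P := Module.Finite.of_surjective _ (LinearMap.range_eq_top.1 hy)
    obtain ⟨s, h0, h1⟩ := exists_compositionSeries_of_isNoetherian_isArtinian A P
    exact ⟨_, _, _, _, _, _, _, P, _, _, π, hS, hSe, hS, hSe, hπ, s, h0, h1, rfl⟩
  exact ⟨Nat.sSup_mem hne hbdd, fun n hn => le_csSup hbdd hn⟩

end LargestEntry

section GroupAlgebras

variable {k : Type} [Field k] {G : Type u} [Group G]

/-- In particular, every block of the group algebra of a finite group has a largest Cartan
invariant. -/
theorem isGreatest_largestCartan_groupAlgebra [Finite G] {e : MonoidAlgebra k G}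
    (he : IsBlockIdempotent e) : IsGreatest (cartanEntries e) (largestCartan e) :=
  have : IsArtinianRing (MonoidAlgebra k G) := IsArtinianRing.of_finite k _
  isGreatest_largestCartan he

/-- The block `kG e` covers the block `kN f` of the normal subgroup `N`, i.e. the product of `e`
with (the image in `kG` of) `f` is not zero. -/
def CoversBlock (N : Subgroup G) (e : MonoidAlgebra k G) (f : MonoidAlgebra k N) : Prop :=
  e * MonoidAlgebra.mapDomainRingHom k N.subtype f ≠ 0

/-- The block `k(G/Z) f` is dominated by (or: corresponds to) the block `kG e`, i.e. `f` occurs in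
the image of `e` under the canonical ring homomorphism `kG → k(G/Z)`. -/
def DominatesBlock (Z : Subgroup G) [Z.Normal] (e : MonoidAlgebra k G)
    (f : MonoidAlgebra k (G ⧸ Z)) : Prop :=
  MonoidAlgebra.mapDomainRingHom k (QuotientGroup.mk' Z) e * f = f

end GroupAlgebras

/-! If `Q` is a projective cover of a simple module `T`, the multiplicity of `T` in `M` is the
length of `Hom(Q, M)` over `End(Q)ᵐᵒᵖ`: this length is additive, equals 1 on `T` and 0 on other
simples. For any projective `Q` with a nonzero map to `T` it is still an upper bound
(`factorCount_le_homLength`), even when `M` and `T` are restricted along a ring homomorphism. Both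
inequalities come from this.

(i) Let `P` cover `S`. As `B` covers `b`, the restrictions of `S` and `T` to `N` contain simple
modules `S₁`, `T₁` of `b`, with covers `Q`, `R`. The lift `Q → P` and its translates present `P` as
a quotient of `[G : N]` conjugates of `Q`. Each conjugate covers a conjugate of `S₁`; it contributes
at most `c(b)` to `Hom(R, -)`, or nothing if it lies outside `b`.

(ii) Along a surjection of rings simple modules stay simple, and the cover of `S` over the target is
a quotient of the one over the source. For `p = 2`, the kernel of `kG → k(G/Z)` is generated by a
nilpotent ideal of the centre, so central idempotents lift to central ones and the image of `e` is
itself a block idempotent. -/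

/-! ### Length of `Hom(Q, M)` over the endomorphism ring of `Q`. -/

section HomLength

variable {B : Type u} [Ring B]

/-- The group `Hom_B(Q, M)` is a right module over the endomorphism ring of `Q`. -/
abbrev homModule (Q M : Type u) [AddCommGroup Q] [Module B Q] [AddCommGroup M] [Module B M] :
    Module (Module.End B Q)ᵐᵒᵖ (Q →ₗ[B] M) where
  smul a h := h.comp a.unop
  one_smul _ := rfl
  mul_smul _ _ _ := rfl
  smul_zero _ := rfl
  smul_add _ _ _ := rfl
  add_smul a b h := LinearMap.comp_add a.unop b.unop h
  zero_smul h := LinearMap.comp_zero h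

attribute [local instance] homModule

/-- The length of `Hom_B(Q, M)` as a module over the opposite of the endomorphism ring of `Q`. -/
noncomputable def homLength (Q M : Type u) [AddCommGroup Q] [Module B Q] [AddCommGroup M]
    [Module B M] : ℕ∞ :=
  Module.length (Module.End B Q)ᵐᵒᵖ (Q →ₗ[B] M)

variable {Q : Type u} [AddCommGroup Q] [Module B Q]

/-- Composition with a linear map, as a map of right `End_B(Q)`-modules. -/
def homComp (Q : Type u) [AddCommGroup Q] [Module B Q] {M N : Type u} [AddCommGroup M] [Module B M]
    [AddCommGroup N] [Module B N] (f : M →ₗ[B] N) :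
    (Q →ₗ[B] M) →ₗ[(Module.End B Q)ᵐᵒᵖ] (Q →ₗ[B] N) where
  toFun h := f.comp h
  map_add' _ _ := LinearMap.comp_add _ _ _
  map_smul' _ _ := rfl

variable {M N K : Type u} [AddCommGroup M] [Module B M] [AddCommGroup N] [Module B N]
  [AddCommGroup K] [Module B K]

theorem homComp_surjective [Module.Projective B Q] {f : M →ₗ[B] N} (hf : Function.Surjective f) :
    Function.Surjective (homComp Q f) := fun h =>
  Module.projective_lifting_property f h hf

theorem homLength_le_of_surjective [Module.Projective B Q] {f : M →ₗ[B] N}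
    (hf : Function.Surjective f) : homLength (B := B) Q N ≤ homLength (B := B) Q M :=
  Module.length_le_of_surjective _ (homComp_surjective hf)

theorem homLength_eq_add [Module.Projective B Q] {f : M →ₗ[B] N} {g : N →ₗ[B] K}
    (hf : Function.Injective f) (hg : Function.Surjective g) (H : Function.Exact f g) :
    homLength (B := B) Q N = homLength (B := B) Q M + homLength (B := B) Q K := by
  refine Module.length_eq_add_of_exact (homComp Q f) (homComp Q g) (fun h h' e => ?_)
    (homComp_surjective hg) (fun h => ⟨fun e => ?_, ?_⟩)
  · ext x
    exact hf (LinearMap.congr_fun e x)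
  · have hr : ∀ x, h x ∈ LinearMap.range f := fun x => (H _).1 (LinearMap.congr_fun e x)
    refine ⟨(LinearEquiv.ofInjective f hf).symm.toLinearMap.comp (h.codRestrict _ hr), ?_⟩
    ext x
    change f ((LinearEquiv.ofInjective f hf).symm ⟨h x, hr x⟩) = h x
    exact congrArg Subtype.val ((LinearEquiv.ofInjective f hf).apply_symm_apply ⟨h x, hr x⟩)
  · rintro ⟨h', rfl⟩
    ext x
    exact H.apply_apply_eq_zero (h' x)

theorem homLength_congr (e : M ≃ₗ[B] N) : homLength (B := B) Q M = homLength (B := B) Q N := by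
  refine LinearEquiv.length_eq (LinearEquiv.ofBijective (homComp Q e.toLinearMap) ⟨?_, ?_⟩)
  · intro h h' hh
    ext x
    exact e.injective (LinearMap.congr_fun hh x)
  · intro h
    exact ⟨e.symm.toLinearMap.comp h, by ext x; exact e.apply_symm_apply _⟩

theorem homLength_eq_zero (h : ∀ f : Q →ₗ[B] M, f = 0) : homLength (B := B) Q M = 0 :=
  Module.length_eq_zero_iff.2 ⟨fun f g => (h f).trans (h g).symm⟩

theorem one_le_homLength {f : Q →ₗ[B] M} (hf : f ≠ 0) : 1 ≤ homLength (B := B) Q M :=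
  have : Nontrivial (Q →ₗ[B] M) := ⟨f, 0, hf⟩
  Order.one_le_iff_pos.2 Module.length_pos

theorem homLength_le_sum [Module.Projective B Q] {ι : Type u} [Fintype ι] {X : ι → Type u}
    [∀ i, AddCommGroup (X i)] [∀ i, Module B (X i)] (f : (Π i, X i) →ₗ[B] M)
    (hf : Function.Surjective f) :
    homLength (B := B) Q M ≤ ∑ i, homLength (B := B) Q (X i) := by
  refine (homLength_le_of_surjective hf).trans ?_
  let F : (Q →ₗ[B] (Π i, X i)) →ₗ[(Module.End B Q)ᵐᵒᵖ] (Π i, Q →ₗ[B] X i) :=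
    LinearMap.pi fun i => homComp Q (LinearMap.proj i)
  have hF : Function.Injective F := fun h h' e => by
    ext x i
    exact LinearMap.congr_fun (congrFun e i) x
  exact (Module.length_le_of_injective F hF).trans_eq (Module.length_pi_of_fintype _ _)

variable {T : Type u} [AddCommGroup T] [Module B T]

/-- A nonzero map `Q → T` is onto, so by projectivity every map `Q → T` factors through it; thus
each nonzero element generates `Hom(Q, T)`. -/
theorem homLength_self_eq_one [IsSimpleModule B T] {π : Q →ₗ[B] T} (hπ : IsProjectiveCover π) :
    homLength (B := B) Q T = 1 := by
  have := hπ.projective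
  have := IsSimpleModule.nontrivial B T
  have hne : Nontrivial (Q →ₗ[B] T) := by
    refine ⟨π, 0, fun h => ?_⟩
    obtain ⟨x, hx⟩ := exists_ne (0 : T)
    obtain ⟨y, rfl⟩ := hπ.surjective x
    exact hx (by simp [h])
  refine Module.length_eq_one_iff.2 (isSimpleModule_iff_toSpanSingleton_surjective.2 ⟨hne, ?_⟩)
  intro φ hφ ψ
  obtain ⟨α, hα⟩ := Module.projective_lifting_property φ ψ
    (LinearMap.surjective_of_ne_zero hφ)
  exact ⟨MulOpposite.op α, hα⟩

/-- A projective cover of a simple module `T` has no simple quotient other than `T`. -/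
theorem homLength_simple_eq_zero [IsSimpleModule B T] [IsSimpleModule B M] {π : Q →ₗ[B] T}
    (hπ : IsProjectiveCover π) (h : ¬ Nonempty (M ≃ₗ[B] T)) : homLength (B := B) Q M = 0 := by
  refine homLength_eq_zero fun φ => by_contra fun hφ => h ?_
  have hs := LinearMap.surjective_of_ne_zero hφ
  have hc := LinearMap.isCoatom_ker_of_surjective hs
  -- Otherwise the maximal submodule `ker φ` and `ker π` span `Q`, against superfluousness of `ker
  -- π`.
  have hle : LinearMap.ker π ≤ LinearMap.ker φ := by
    by_contra hle
    exact hc.1 (hπ.superfluous _ (hc.2 _ (left_lt_sup.2 hle)))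
  have heq := ((LinearMap.isCoatom_ker_of_surjective hπ.surjective).le_iff.1 hle).resolve_left hc.1
  exact ⟨(φ.quotKerEquivOfSurjective hs).symm.trans
    ((Submodule.quotEquivOfEq _ _ heq).trans (π.quotKerEquivOfSurjective hπ.surjective))⟩

end HomLength

/-! ### Composition series over `A` measured by projective `B`-modules. -/

section Tower

variable {B : Type u} [Ring B] {A : Type u} [Ring A] [Module B A]
  {Q : Type u} [AddCommGroup Q] [Module B Q]
  {M : Type u} [AddCommGroup M] [Module B M] [Module A M] [IsScalarTower B A M]

theorem homLength_add_quotient [Module.Projective B Q] {U V : Submodule A M} (h : U ≤ V) :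
    homLength (B := B) Q V = homLength (B := B) Q U +
      homLength (B := B) Q (V ⧸ U.submoduleOf V) := by
  let f : U →ₗ[B] V := (Submodule.inclusion h).restrictScalars B
  let g : V →ₗ[B] (V ⧸ U.submoduleOf V) := (U.submoduleOf V).mkQ.restrictScalars B
  have hf : Function.Injective f := Submodule.inclusion_injective h
  have hg : Function.Surjective g := Submodule.mkQ_surjective (U.submoduleOf V)
  refine homLength_eq_add hf hg fun x => ?_
  exact (Submodule.Quotient.mk_eq_zero (U.submoduleOf V)).trans
    ⟨fun hx => ⟨⟨x, hx⟩, rfl⟩, by rintro ⟨y, rfl⟩; exact y.2⟩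

theorem homLength_eq_sum_factors [Module.Projective B Q] (s : CompositionSeries (Submodule A M))
    (h0 : s.head = ⊥) (h1 : s.last = ⊤) :
    homLength (B := B) Q M = ∑ i : Fin s.length,
      homLength (B := B) Q (s i.succ ⧸ (s i.castSucc).submoduleOf (s i.succ)) := by
  have key : ∀ j : Fin (s.length + 1), homLength (B := B) Q (s j) =
      ∑ i : Fin s.length with i.castSucc < j,
        homLength (B := B) Q (s i.succ ⧸ (s i.castSucc).submoduleOf (s i.succ)) := by
    intro j
    induction j using Fin.induction with
    | zero =>
      have : s 0 = ⊥ := h0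
      rw [Finset.filter_false_of_mem (by simp), Finset.sum_empty]
      refine homLength_eq_zero fun f => ?_
      ext x
      exact (Submodule.mem_bot A).1 (this.le (f x).2)
    | succ i ih =>
      rw [homLength_add_quotient (s.step i).le, ih]
      have : (Finset.univ.filter fun l : Fin s.length => l.castSucc < i.succ) =
          insert i (Finset.univ.filter fun l : Fin s.length => l.castSucc < i.castSucc) := by
        ext l
        simp only [Finset.mem_filter, Finset.mem_univ, true_and, Finset.mem_insert,
          Fin.castSucc_lt_castSucc_iff, Fin.castSucc_lt_succ_iff]
        exact le_iff_eq_or_lt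
      rw [this, Finset.sum_insert (by simp), add_comm]
  have hl := key (Fin.last _)
  rw [Finset.filter_true_of_mem (by simp [Fin.castSucc_lt_last])] at hl
  rw [← hl]
  have ht : s (Fin.last _) = ⊤ := h1
  rw [ht]
  exact (homLength_congr ((Submodule.topEquiv (R := A) (M := M)).restrictScalars B)).symm

/-- Only an inequality: over `B` the module `T` need not be simple, and factors other than `T` may
also receive maps from `Q`. -/
theorem factorCount_le_homLength [Module.Projective B Q] (s : CompositionSeries (Submodule A M))
    (h0 : s.head = ⊥) (h1 : s.last = ⊤) {T : Type u} [AddCommGroup T] [Module B T] [Module A T]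
    [IsScalarTower B A T] {f : Q →ₗ[B] T} (hf : f ≠ 0) :
    (factorCount s T : ℕ∞) ≤ homLength (B := B) Q M := by
  classical
  rw [homLength_eq_sum_factors s h0 h1, factorCount, Finset.card_filter, Nat.cast_sum]
  refine Finset.sum_le_sum fun i _ => ?_
  split_ifs with h
  · obtain ⟨e⟩ := h
    rw [homLength_congr (e.restrictScalars B)]
    exact_mod_cast one_le_homLength hf
  · simp

end Tower

/-! ### Cartan invariants as Hom lengths; modules and central idempotents. -/

section Multiplicity

variable {A : Type u} [Ring A]

theorem isSimpleModule_factor {M : Type u} [AddCommGroup M] [Module A M]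
    (s : CompositionSeries (Submodule A M)) (i : Fin s.length) :
    IsSimpleModule A (s i.succ ⧸ (s i.castSucc).submoduleOf (s i.succ)) :=
  (covBy_iff_quot_is_simple (s.step i).le).1 (s.step i)

variable {T Q M : Type u} [AddCommGroup T] [Module A T] [AddCommGroup Q] [Module A Q]
  [AddCommGroup M] [Module A M]

theorem factorCount_eq_homLength [IsSimpleModule A T] {π : Q →ₗ[A] T} (hπ : IsProjectiveCover π)
    (s : CompositionSeries (Submodule A M)) (h0 : s.head = ⊥) (h1 : s.last = ⊤) :
    (factorCount s T : ℕ∞) = homLength (B := A) Q M := by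
  classical
  have := hπ.projective
  rw [homLength_eq_sum_factors s h0 h1, factorCount, Finset.card_filter, Nat.cast_sum]
  refine Finset.sum_congr rfl fun i _ => ?_
  have := isSimpleModule_factor s i
  split_ifs with h
  · obtain ⟨e⟩ := h
    exact (homLength_self_eq_one hπ).symm.trans (homLength_congr (B := A) e).symm
  · exact (homLength_simple_eq_zero hπ h).symm

variable {S P : Type u} [AddCommGroup S] [Module A S] [AddCommGroup P] [Module A P]

/-- `homLength` computes Cartan invariants, so it is bounded by the largest one. -/
theorem homLength_le_largestCartan [IsArtinianRing A] {e : A} (he : IsBlockIdempotent e)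
    [IsSimpleModule A S] [IsSimpleModule A T] (hS : BelongsToBlock e S) (hT : BelongsToBlock e T)
    {ρ : P →ₗ[A] S} (hρ : IsProjectiveCover ρ) {π : Q →ₗ[A] T} (hπ : IsProjectiveCover π) :
    homLength (B := A) Q P ≤ (largestCartan e : ℕ∞) := by
  obtain ⟨y, hy⟩ := hρ.exists_generator
  have hfin : Module.Finite A P := Module.Finite.of_surjective _ (LinearMap.range_eq_top.1 hy)
  obtain ⟨s, h0, h1⟩ := exists_compositionSeries_of_isNoetherian_isArtinian A P
  rw [← factorCount_eq_homLength hπ s h0 h1]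
  exact_mod_cast (isGreatest_largestCartan he).2
    ⟨S, _, _, T, _, _, P, _, _, ρ, inferInstance, hS, inferInstance, hT, hρ, s, h0, h1, rfl⟩

/-- Schur's lemma: multiplication by `e` is linear, hence zero or onto, and an idempotent map that
is onto is the identity. -/
theorem smul_eq_zero_or_belongsToBlock {e : A} (hc : e ∈ Subring.center A)
    (hi : IsIdempotentElem e) [IsSimpleModule A S] :
    (∀ x : S, e • x = 0) ∨ BelongsToBlock e S := by
  let L : S →ₗ[A] S :=
    { toFun := fun x => e • x
      map_add' := smul_add e
      map_smul' := fun a x => by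
        simp only [RingHom.id_apply, smul_smul, Subring.mem_center_iff.1 hc a] }
  rcases eq_or_ne L 0 with h | h
  · exact .inl fun x => LinearMap.congr_fun h x
  · refine .inr fun x => ?_
    obtain ⟨y, rfl⟩ := LinearMap.surjective_of_ne_zero h x
    change e • e • y = e • y
    rw [smul_smul, hi.eq]

/-- Since `e` fixes `S`, `eP + ker ρ = P`, so `eP = P`. -/
theorem IsProjectiveCover.belongsToBlock {e : A} (hc : e ∈ Subring.center A)
    {ρ : P →ₗ[A] S} (hρ : IsProjectiveCover ρ) (hS : BelongsToBlock e S)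
    (hi : IsIdempotentElem e) : BelongsToBlock e P := by
  let L : P →ₗ[A] P :=
    { toFun := fun x => e • x
      map_add' := smul_add e
      map_smul' := fun a x => by
        simp only [RingHom.id_apply, smul_smul, Subring.mem_center_iff.1 hc a] }
  have h : LinearMap.range L = ⊤ := by
    refine hρ.superfluous _ (eq_top_iff.2 fun x _ => Submodule.mem_sup.2
      ⟨e • x, ⟨x, rfl⟩, x - e • x, ?_, by abel⟩)
    simp [hS (ρ x)]
  intro x
  obtain ⟨y, rfl⟩ := LinearMap.range_eq_top.1 h x
  change e • e • y = e • y
  rw [smul_smul, hi.eq]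

end Multiplicity

/-! ### Cartan invariants along a surjection of rings. -/

section Inflation

variable {A C : Type u} [Ring A] [Ring C]

theorem largestCartan_le_of_surjective [IsArtinianRing A] [IsArtinianRing C] (φ : A →+* C)
    (hφ : Function.Surjective φ) {e : A} {f : C} (he : IsBlockIdempotent e)
    (hf : IsBlockIdempotent f) (hef : φ e * f = f) : largestCartan f ≤ largestCartan e := by
  obtain ⟨S, _, _, T, _, _, P, _, _, π, hS, hSf, hT, hTf, hπ, s, h0, h1, hn⟩ :=
    (isGreatest_largestCartan hf).1
  let _ : Module A C := Module.compHom C φ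
  let _ : Module A S := Module.compHom S φ
  let _ : Module A T := Module.compHom T φ
  let _ : Module A P := Module.compHom P φ
  have _ : IsScalarTower A C S := ⟨fun a c x => mul_smul (φ a) c x⟩
  have _ : IsScalarTower A C T := ⟨fun a c x => mul_smul (φ a) c x⟩
  have _ : IsScalarTower A C P := ⟨fun a c x => mul_smul (φ a) c x⟩
  have simple : ∀ {X : Type u} [AddCommGroup X] [Module C X] [Module A X],
      (∀ (a : A) (x : X), a • x = φ a • x) → IsSimpleModule C X → IsSimpleModule A X := by
    intro X _ _ _ h hX
    rw [isSimpleModule_iff_toSpanSingleton_surjective] at hX ⊢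
    refine ⟨hX.1, fun x hx y => ?_⟩
    obtain ⟨c, hc⟩ := hX.2 x hx y
    obtain ⟨a, rfl⟩ := hφ c
    exact ⟨a, (h a x).trans hc⟩
  have belongs : ∀ {X : Type u} [AddCommGroup X] [Module C X] [Module A X],
      (∀ (a : A) (x : X), a • x = φ a • x) → BelongsToBlock f X → BelongsToBlock e X := by
    intro X _ _ _ h hX x
    rw [h, ← hX x, smul_smul, hef]
  have hSA : IsSimpleModule A S := simple (fun _ _ => rfl) hS
  have hTA : IsSimpleModule A T := simple (fun _ _ => rfl) hT
  obtain ⟨P', _, _, ρ, hρ⟩ := exists_isProjectiveCover (A := A) S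
  obtain ⟨Q, _, _, σ, hσ⟩ := exists_isProjectiveCover (A := A) T
  have := hρ.projective
  have := hσ.projective
  obtain ⟨ψ, hψ⟩ := Module.projective_lifting_property (π.restrictScalars A) ρ hπ.surjective
  have hψs : Function.Surjective ψ := by
    -- As `φ` is onto, the range of `ψ` is a `C`-submodule, so superfluousness of `ker π` over `C`
    -- applies.
    let U : Submodule C P :=
      { (LinearMap.range ψ) with
        smul_mem' := fun c x hx => by
          obtain ⟨a, rfl⟩ := hφ c
          exact (LinearMap.range ψ).smul_mem a hx }
    have hU : U = ⊤ := by
      refine hπ.superfluous U (eq_top_iff.2 fun x _ => ?_)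
      obtain ⟨y, hy⟩ := hρ.surjective (π x)
      refine Submodule.mem_sup.2 ⟨ψ y, ⟨y, rfl⟩, x - ψ y, ?_, by abel⟩
      have : π (ψ y) = ρ y := LinearMap.congr_fun hψ y
      simp [this, hy]
    intro x
    exact (hU.ge Submodule.mem_top : x ∈ U)
  have hσ0 : σ ≠ 0 := by
    rintro rfl
    have := IsSimpleModule.nontrivial A T
    obtain ⟨x, hx⟩ := exists_ne (0 : T)
    obtain ⟨y, rfl⟩ := hσ.surjective x
    exact hx rfl
  have key : (largestCartan f : ℕ∞) ≤ largestCartan e := by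
    rw [hn]
    exact (factorCount_le_homLength s h0 h1 hσ0).trans ((homLength_le_of_surjective hψs).trans
      (homLength_le_largestCartan he (belongs (fun _ _ => rfl) hSf)
        (belongs (fun _ _ => rfl) hTf) hρ hσ))
  exact_mod_cast key

end Inflation

/-! ### Block idempotents modulo a nilpotent ideal of central scalars. -/

section CentralExtension

variable {A C : Type u} [Ring A] [Ring C]

theorem eq_zero_or_eq_of_mul_eq {e f : A} (he : IsBlockIdempotent e)
    (hf : f ∈ Subring.center A) (hi : IsIdempotentElem f) : f * e = 0 ∨ f * e = e := by
  refine he.primitive _ (mul_mem hf he.mem_center) ?_ (by rw [mul_assoc, he.idempotent.eq])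
  exact hi.mul_of_commute ((Subring.mem_center_iff.1 hf e).symm) he.idempotent

variable {R : Type u} [CommRing R] [Algebra R A]

theorem isNilpotent_of_mem_smul_top {I : Ideal R} (hI : IsNilpotent I) {a : A}
    (ha : a ∈ I • (⊤ : Submodule R A)) : IsNilpotent a := by
  obtain ⟨n, hn⟩ := hI
  have key : ∀ m, a ^ m ∈ I ^ m • (⊤ : Submodule R A) := by
    intro m
    induction m with
    | zero => simp
    | succ m ih =>
      have h := Submodule.mem_map_of_mem (f := LinearMap.mulRight R (a ^ m)) ha
      rw [Submodule.map_smul''] at h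
      rw [pow_succ' a, pow_succ' I, mul_smul]
      refine Submodule.smul_mono le_rfl ?_ h
      rintro _ ⟨x, -, rfl⟩
      have h' := Submodule.mem_map_of_mem (f := LinearMap.mulLeft R x) ih
      rw [Submodule.map_smul''] at h'
      exact Submodule.smul_mono le_rfl le_top h'
  refine ⟨n, ?_⟩
  have := key n
  rw [hn] at this
  simpa using this

/-- If `ker φ` is generated by a nilpotent ideal of central scalars, then every idempotent of `A`
whose image under `φ` is central is central itself. -/
theorem mem_center_of_map_mem_center (φ : A →+* C) {I : Ideal R} (hI : IsNilpotent I)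
    (hker : ∀ a, φ a = 0 → a ∈ I • (⊤ : Submodule R A)) {f : A} (hi : IsIdempotentElem f)
    (hc : ∀ a, φ a * φ f = φ f * φ a) : f ∈ Subring.center A := by
  obtain ⟨n, hn⟩ := hI
  -- If `φ` kills `gAh`, then `gAh ⊆ IA`; applying the projection `x ↦ gxh` gives `gAh ⊆ I·gAh`, and
  -- iteration gives `gAh = 0`.
  have corner : ∀ g h : A, IsIdempotentElem g → IsIdempotentElem h →
      (∀ x, φ (g * x * h) = 0) → ∀ x, g * x * h = 0 := by
    intro g h hg hh hgh
    let L : A →ₗ[R] A := (LinearMap.mulRight R h).comp (LinearMap.mulLeft R g)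
    have hL : ∀ x, L (L x) = L x := fun x => by
      change g * (g * x * h) * h = g * x * h
      rw [← mul_assoc, ← mul_assoc, hg.eq, mul_assoc _ h h, hh.eq]
    have key : ∀ m, LinearMap.range L ≤ I ^ m • LinearMap.range L := by
      intro m
      induction m with
      | zero => simp
      | succ m ih =>
        rintro _ ⟨x, rfl⟩
        have h2 := Submodule.mem_map_of_mem (f := L) (hker _ (hgh x))
        rw [Submodule.map_smul'', Submodule.map_top] at h2
        rw [pow_succ', mul_smul, ← hL x]
        exact Submodule.smul_mono le_rfl ih h2
    intro x
    have := key n ⟨x, rfl⟩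
    rw [hn] at this
    simpa [L] using this
  -- Both off-diagonal Peirce corners of `f` vanish, whence `fx = fxf = xf`.
  have h1 := corner f (1 - f) hi hi.one_sub (fun x => by
    simp only [map_mul, map_sub, mul_sub, mul_one]
    rw [mul_assoc, hc, ← mul_assoc, ← map_mul φ f f, hi.eq, sub_self])
  have h2 := corner (1 - f) f hi.one_sub hi (fun x => by
    simp only [map_mul, map_sub, sub_mul, one_mul]
    rw [← hc, mul_assoc, ← map_mul φ f f, hi.eq, sub_self])
  refine Subring.mem_center_iff.2 fun x => ?_
  have h1' := h1 x
  have h2' := h2 x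
  rw [mul_sub, mul_one, sub_eq_zero] at h1'
  rw [sub_mul, sub_mul, one_mul, sub_eq_zero] at h2'
  rw [h2', ← h1']

theorem map_mem_center {φ : A →+* C} (hφ : Function.Surjective φ) {e : A}
    (he : e ∈ Subring.center A) : φ e ∈ Subring.center C := by
  refine Subring.mem_center_iff.2 fun c => ?_
  obtain ⟨a, rfl⟩ := hφ c
  rw [← map_mul, Subring.mem_center_iff.1 he, map_mul]

/-- Central idempotents of `C` lift to central idempotents of `A`, so primitivity of `e` passes to
`φ e`; and `φ e ≠ 0` because a nilpotent idempotent is zero. -/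
theorem isBlockIdempotent_map {φ : A →+* C} (hφ : Function.Surjective φ) {I : Ideal R}
    (hI : IsNilpotent I) (hker : ∀ a, φ a = 0 → a ∈ I • (⊤ : Submodule R A)) {e : A}
    (he : IsBlockIdempotent e) : IsBlockIdempotent (φ e) := by
  refine ⟨map_mem_center hφ he.mem_center, he.idempotent.map φ, fun h => he.ne_zero ?_, ?_⟩
  · obtain ⟨n, hn⟩ := isNilpotent_of_mem_smul_top hI (hker e h)
    have := he.idempotent.pow_succ_eq n
    rw [pow_succ, hn, zero_mul] at this
    exact this.symm
  · intro f hf hfi hfe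
    obtain ⟨f', hf'i, rfl⟩ := exists_isIdempotentElem_eq_of_ker_isNilpotent φ
      (fun x hx => isNilpotent_of_mem_smul_top hI (hker x hx)) f (hφ f) hfi
    have hf' := mem_center_of_map_mem_center φ hI hker hf'i
      fun a => Subring.mem_center_iff.1 hf (φ a)
    rw [← hfe, ← map_mul]
    rcases eq_zero_or_eq_of_mul_eq he hf' hf'i with h | h
    · exact .inl (by rw [h, map_zero])
    · exact .inr (by rw [h])

end CentralExtension

/-! ### The kernel of `kG → k(G/Z)` for a central `p`-subgroup `Z`. -/

section GroupAlgebra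

variable {k : Type} [Field k] {G : Type u} [Group G]

theorem mapDomainRingHom_mk'_surjective (Z : Subgroup G) [Z.Normal] :
    Function.Surjective (MonoidAlgebra.mapDomainRingHom k (QuotientGroup.mk' Z)) := by
  intro a
  induction a using MonoidAlgebra.induction_linear with
  | zero => exact ⟨0, map_zero _⟩
  | add a b ha hb =>
    obtain ⟨a, rfl⟩ := ha
    obtain ⟨b, rfl⟩ := hb
    exact ⟨a + b, map_add _ _ _⟩
  | single g c =>
    obtain ⟨g, rfl⟩ := QuotientGroup.mk'_surjective Z g
    exact ⟨MonoidAlgebra.single g c, by simp⟩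

theorem single_mem_center {z : G} (hz : z ∈ Subgroup.center G) :
    MonoidAlgebra.single z (1 : k) ∈ Subring.center (MonoidAlgebra k G) := by
  refine Subring.mem_center_iff.2 fun a => ?_
  induction a using MonoidAlgebra.induction_linear with
  | zero => simp
  | add a b ha hb => rw [add_mul, mul_add, ha, hb]
  | single g c => simp [MonoidAlgebra.single_mul_single, Subgroup.mem_center_iff.1 hz g]

/-- The ideal of the centre of `kG` generated by the elements `z - 1` with `z ∈ Z`. -/
noncomputable def centralAugmentation (k : Type) [Field k] {Z : Subgroup G}
    (hZ : Z ≤ Subgroup.center G) : Ideal (Subring.center (MonoidAlgebra k G)) :=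
  Ideal.span (Set.range fun z : Z =>
    ⟨MonoidAlgebra.single (z : G) 1, single_mem_center (hZ z.2)⟩ - 1)

/-- In characteristic `p`, `(z - 1) ^ p ^ n = z ^ p ^ n - 1`, so the ideal has finitely many
generators, all nilpotent. -/
theorem isNilpotent_centralAugmentation (p : ℕ) [Fact p.Prime] [CharP k p] [Finite G]
    {Z : Subgroup G} (hZ : Z ≤ Subgroup.center G) (hp : IsPGroup p Z) :
    IsNilpotent (centralAugmentation k hZ) := by
  refine (Ideal.FG.isNilpotent_iff_le_nilradical ?_).2 (Ideal.span_le.2 ?_)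
  · exact Submodule.fg_span (Set.finite_range _)
  · rintro _ ⟨z, rfl⟩
    obtain ⟨n, hn⟩ := hp z
    refine mem_nilradical.2 ⟨p ^ n, Subtype.ext ?_⟩
    have : CharP (MonoidAlgebra k G) p :=
      charP_of_injective_algebraMap (algebraMap k (MonoidAlgebra k G)).injective p
    have hz : (z : G) ^ p ^ n = 1 := congrArg Subtype.val hn
    change (MonoidAlgebra.single (z : G) (1 : k) - 1) ^ p ^ n = 0
    rw [sub_pow_char_pow_of_commute (p := p) _ (Commute.one_right _), MonoidAlgebra.single_pow, hz, one_pow, one_pow,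
      ← MonoidAlgebra.one_def, sub_self]

theorem mem_centralAugmentation_smul_top {Z : Subgroup G} [Z.Normal] (hZ : Z ≤ Subgroup.center G)
    (a : MonoidAlgebra k G)
    (ha : MonoidAlgebra.mapDomainRingHom k (QuotientGroup.mk' Z) a = 0) :
    a ∈ centralAugmentation k hZ •
      (⊤ : Submodule (Subring.center (MonoidAlgebra k G)) (MonoidAlgebra k G)) := by
  -- Replacing each `g` by its coset representative `gz` changes `a` by multiples of `g - gz = (z -
  -- 1)(-g)`; if `a` maps to 0, nothing but these changes remains.
  have key : ∀ a : MonoidAlgebra k G, a - MonoidAlgebra.mapDomain (Quotient.out : G ⧸ Z → G)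
      (MonoidAlgebra.mapDomainRingHom k (QuotientGroup.mk' Z) a) ∈ centralAugmentation k hZ •
      (⊤ : Submodule (Subring.center (MonoidAlgebra k G)) (MonoidAlgebra k G)) := by
    intro a
    induction a using MonoidAlgebra.induction_linear with
    | zero => simp
    | add a b ha hb =>
      rw [map_add, MonoidAlgebra.mapDomain_add, add_sub_add_comm]
      exact add_mem ha hb
    | single g c =>
      obtain ⟨z, hz⟩ := QuotientGroup.mk_out_eq_mul Z g
      have h : MonoidAlgebra.single g c - MonoidAlgebra.mapDomain (Quotient.out : G ⧸ Z → G)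
          (MonoidAlgebra.mapDomainRingHom k (QuotientGroup.mk' Z) (MonoidAlgebra.single g c)) =
          (⟨MonoidAlgebra.single (z : G) 1, single_mem_center (hZ z.2)⟩ - 1 :
            Subring.center (MonoidAlgebra k G)) • MonoidAlgebra.single g (-c) := by
        have hzc : (z : G) * g = g * z := (Subgroup.mem_center_iff.1 (hZ z.2) g).symm
        rw [Subring.smul_def]
        change _ = (MonoidAlgebra.single (z : G) (1 : k) - 1) * MonoidAlgebra.single g (-c)
        simp [sub_mul, MonoidAlgebra.single_mul_single, hz, hzc, MonoidAlgebra.single_neg]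
      rw [h]
      exact Submodule.smul_mem_smul (Ideal.subset_span ⟨z, rfl⟩) Submodule.mem_top
  simpa [ha] using key a

theorem existsUnique_dominatesBlock (p : ℕ) [Fact p.Prime] [CharP k p] [Finite G]
    {e : MonoidAlgebra k G} (he : IsBlockIdempotent e) {Z : Subgroup G} [Z.Normal]
    (hZ : Z ≤ Subgroup.center G) (hp : IsPGroup p Z) :
    ∃! f : MonoidAlgebra k (G ⧸ Z), IsBlockIdempotent f ∧ DominatesBlock Z e f := by
  have h := isBlockIdempotent_map (mapDomainRingHom_mk'_surjective (k := k) Z)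
    (isNilpotent_centralAugmentation p hZ hp) (mem_centralAugmentation_smul_top hZ) he
  refine ⟨_, ⟨h, h.idempotent⟩, fun f hf => ?_⟩
  refine (h.primitive f hf.1.mem_center hf.1.idempotent ?_).resolve_left hf.1.ne_zero
  rw [Subring.mem_center_iff.1 h.mem_center]
  exact hf.2

end GroupAlgebra

/-! ### Modules twisted by a ring automorphism. -/

section Twist

variable {A : Type u} [Ring A]

/-- The module `M` with the action of the ring twisted by an automorphism. -/
def Twist (_ : A ≃+* A) (M : Type u) : Type u := M

variable (σ : A ≃+* A) {M N : Type u} [AddCommGroup M] [Module A M] [AddCommGroup N] [Module A N]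

instance : AddCommGroup (Twist σ M) := inferInstanceAs (AddCommGroup M)

instance : Module A (Twist σ M) := Module.compHom M σ.toRingHom

/-- The identity map as a semilinear map onto the twisted module. -/
def toTwist : M →ₛₗ[(σ.symm : A →+* A)] Twist σ M where
  toFun x := x
  map_add' _ _ := rfl
  map_smul' a x := by
    change a • x = σ (σ.symm a) • x
    rw [σ.apply_symm_apply]

/-- A linear map is also linear for the twisted actions. -/
def Twist.map (f : M →ₗ[A] N) : Twist σ M →ₗ[A] Twist σ N where
  toFun := f
  map_add' := f.map_add
  map_smul' a := f.map_smul (σ a)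

instance [Module.Projective A M] : Module.Projective A (Twist σ M) := by
  have : RingHomInvPair (σ.symm : A →+* A) (σ : A →+* A) :=
    ⟨by ext x; simp, by ext x; simp⟩
  have : RingHomInvPair (σ : A →+* A) (σ.symm : A →+* A) :=
    ⟨by ext x; simp, by ext x; simp⟩
  exact Module.Projective.of_equiv
    ({ toTwist σ with invFun := fun x => x, left_inv := fun _ => rfl, right_inv := fun _ => rfl } :
      M ≃ₛₗ[(σ.symm : A →+* A)] Twist σ M)

instance [h : IsSimpleModule A M] : IsSimpleModule A (Twist σ M) := by
  rw [isSimpleModule_iff_toSpanSingleton_surjective] at h ⊢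
  refine ⟨h.1, fun x hx y => ?_⟩
  obtain ⟨a, ha⟩ := h.2 x hx y
  refine ⟨σ.symm a, ?_⟩
  change σ (σ.symm a) • (show M from x) = y
  rw [σ.apply_symm_apply]
  exact ha

/-- Twisting leaves the lattice of submodules unchanged. -/
theorem IsProjectiveCover.twist {π : M →ₗ[A] N} (hπ : IsProjectiveCover π) :
    IsProjectiveCover (Twist.map σ π) := by
  have := hπ.projective
  refine ⟨inferInstance, hπ.surjective, fun U hU => ?_⟩
  let U' : Submodule A M := U.comap (toTwist σ)
  have hU' : U' = ⊤ := by
    refine hπ.superfluous U' (eq_top_iff.2 fun x _ => ?_)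
    obtain ⟨y, hy, z, hz, hyz⟩ := Submodule.mem_sup.1 (hU.ge (Submodule.mem_top (x := toTwist σ x)))
    exact Submodule.mem_sup.2 ⟨y, hy, z, hz, hyz⟩
  refine eq_top_iff.2 fun x _ => ?_
  have hx : (show M from x) ∈ U' := hU'.ge Submodule.mem_top
  exact hx

end Twist

/-- The module generated by `f • x` is nonzero, artinian and fixed by `f`; `S` is one of its minimal
submodules. -/
theorem exists_simple_belongsToBlock {A : Type u} [Ring A] [IsArtinianRing A] {f : A}
    (hc : f ∈ Subring.center A) (hi : IsIdempotentElem f) {M : Type u} [AddCommGroup M] [Module A M]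
    {x : M} (hx : f • x ≠ 0) :
    ∃ (S : Type u) (_ : AddCommGroup S) (_ : Module A S) (ι : S →ₗ[A] M),
      Function.Injective ι ∧ IsSimpleModule A S ∧ BelongsToBlock f S := by
  let J : Submodule A M := Submodule.span A {f • x}
  have hJ : BelongsToBlock f J := by
    rintro ⟨y, hy⟩
    obtain ⟨a, rfl⟩ := Submodule.mem_span_singleton.1 hy
    apply Subtype.ext
    change f • a • f • x = a • f • x
    rw [smul_smul, smul_smul, ← Subring.mem_center_iff.1 hc, mul_assoc, hi.eq, smul_smul]
  have : Nontrivial J :=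
    ⟨⟨⟨f • x, Submodule.mem_span_singleton_self _⟩, 0, fun h => hx (congrArg Subtype.val h)⟩⟩
  obtain ⟨m, hm⟩ := IsAtomic.exists_atom (Submodule A J)
  exact ⟨m, _, _, J.subtype.comp m.subtype, J.injective_subtype.comp m.injective_subtype,
    isSimpleModule_iff_isAtom.2 hm, fun y => Subtype.ext (hJ y)⟩

/-! ### Restriction to a normal subgroup. -/

section NormalSubgroup

variable {k : Type} [Field k] {G : Type u} [Group G] {N : Subgroup G} [N.Normal]

/-- Conjugation by an element of `G`, as an automorphism of `kN`. -/
noncomputable def conjEquiv (k : Type) [Field k] (N : Subgroup G) [N.Normal] (g : G) :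
    MonoidAlgebra k N ≃+* MonoidAlgebra k N :=
  MonoidAlgebra.mapDomainRingEquiv k (MulAut.conjNormal g)

theorem map_conjEquiv_mul_single (g : G) (a : MonoidAlgebra k N) :
    MonoidAlgebra.mapDomainRingHom k N.subtype (conjEquiv k N g a) * MonoidAlgebra.single g 1 =
      MonoidAlgebra.single g 1 * MonoidAlgebra.mapDomainRingHom k N.subtype a := by
  induction a using MonoidAlgebra.induction_linear with
  | zero => simp
  | add a b ha hb => rw [map_add, map_add, add_mul, ha, hb, map_add, mul_add]
  | single n c => simp [conjEquiv, MonoidAlgebra.single_mul_single]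

theorem conjEquiv_mul (g h : G) (a : MonoidAlgebra k N) :
    conjEquiv k N (g * h) a = conjEquiv k N g (conjEquiv k N h a) := by
  induction a using MonoidAlgebra.induction_linear with
  | zero => simp
  | add a b ha hb => simp only [map_add, ha, hb]
  | single n c => simp [conjEquiv]

theorem conjEquiv_one (a : MonoidAlgebra k N) : conjEquiv k N 1 a = a := by
  induction a using MonoidAlgebra.induction_linear with
  | zero => simp
  | add a b ha hb => simp only [map_add, ha, hb]
  | single n c => simp [conjEquiv]

theorem single_one_smul_single_smul {M : Type u} [AddCommGroup M] [Module (MonoidAlgebra k G) M]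
    (g : G) (x : M) :
    MonoidAlgebra.single g (1 : k) • MonoidAlgebra.single g⁻¹ (1 : k) • x = x := by
  rw [smul_smul, MonoidAlgebra.single_mul_single, mul_inv_cancel, one_mul,
    ← MonoidAlgebra.one_def, one_smul]

theorem mem_center_of_commute_single {a : MonoidAlgebra k G}
    (h : ∀ g, a * MonoidAlgebra.single g 1 = MonoidAlgebra.single g 1 * a) :
    a ∈ Subring.center (MonoidAlgebra k G) := by
  refine Subring.mem_center_iff.2 fun b => ?_
  induction b using MonoidAlgebra.induction_linear with
  | zero => simp
  | add b c hb hc => rw [add_mul, mul_add, hb, hc]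
  | single g c =>
    have : MonoidAlgebra.single g c = c • MonoidAlgebra.single g (1 : k) := by simp
    rw [this, smul_mul_assoc, mul_smul_comm, h]

/-- If `kGe` covers `kNf`, then no simple module of `kGe` is annihilated by `f`. -/
theorem CoversBlock.exists_smul_ne_zero [Finite G] {e : MonoidAlgebra k G}
    {f : MonoidAlgebra k N} (h : CoversBlock N e f) (he : IsBlockIdempotent e)
    (hf : IsBlockIdempotent f) {T : Type u} [AddCommGroup T] [Module (MonoidAlgebra k G) T]
    [Nontrivial T] (hT : BelongsToBlock e T) :
    ∃ t : T, MonoidAlgebra.mapDomainRingHom k N.subtype f • t ≠ 0 := by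
  classical
  by_contra! h0
  have := Fintype.ofFinite G
  let φ := MonoidAlgebra.mapDomainRingHom k N.subtype
  let F : Subring.center (MonoidAlgebra k N) := ⟨f, hf.mem_center⟩
  have hF : F * F = F := Subtype.ext hf.idempotent
  -- The product `c` of all `1 - ᵍf` is a `G`-stable central idempotent with `fc = 0`. Repeated
  -- conjugates do no harm, the factors being idempotent. If `f` kills `T`, so do its conjugates,
  -- and `c` acts on `T` as 1.
  let z : G → Subring.center (MonoidAlgebra k N) := fun g =>
    1 - Subring.centerCongr (conjEquiv k N g) F
  have hz : ∀ g, (z g : MonoidAlgebra k N) = 1 - conjEquiv k N g f := fun _ => rfl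
  let c := ∏ g, z g
  have hzz : ∀ g, z g * z g = z g := fun g => by
    have : IsIdempotentElem (Subring.centerCongr (conjEquiv k N g) F) :=
      IsIdempotentElem.map hF _
    exact this.one_sub
  have hcc : c * c = c := by
    rw [← Finset.prod_mul_distrib]
    exact Finset.prod_congr rfl fun g _ => hzz g
  have hconj : ∀ g, conjEquiv k N g c = c := by
    intro g
    have h1 : Subring.centerCongr (conjEquiv k N g) c = c := by
      rw [map_prod]
      refine Fintype.prod_equiv (Equiv.mulLeft g) _ _ fun x => Subtype.ext ?_
      change conjEquiv k N g (1 - conjEquiv k N x f) = 1 - conjEquiv k N (g * x) f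
      rw [map_sub, map_one, conjEquiv_mul]
    exact congrArg Subtype.val h1
  have hfc : f * c = 0 := by
    have h1 : F * c = 0 := by
      rw [show c = z 1 * _ from (Finset.mul_prod_erase _ z (Finset.mem_univ 1)).symm, ← mul_assoc]
      have : z 1 = 1 - F := Subtype.ext (by rw [hz, conjEquiv_one]; rfl)
      rw [this, mul_sub, mul_one, hF, sub_self, zero_mul]
    exact congrArg Subtype.val h1
  have hC : φ c ∈ Subring.center (MonoidAlgebra k G) := mem_center_of_commute_single fun g => by
    rw [← map_conjEquiv_mul_single, hconj]
  have hCi : IsIdempotentElem (φ c) := by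
    rw [IsIdempotentElem, ← map_mul]
    exact congrArg (fun x : Subring.center (MonoidAlgebra k N) => φ x) hcc
  have hCT : ∀ t : T, φ c • t = t := by
    refine Finset.prod_induction z
      (fun a : Subring.center (MonoidAlgebra k N) => ∀ t : T, φ a • t = t) ?_ ?_ ?_
    · intro a b ha hb t
      rw [Subring.coe_mul, map_mul, mul_smul, hb, ha]
    · intro t
      rw [Subring.coe_one, map_one, one_smul]
    · intro g _ t
      rw [hz, map_sub, map_one, sub_smul, one_smul, sub_eq_self,
        ← single_one_smul_single_smul (k := k) g t, smul_smul, map_conjEquiv_mul_single, mul_smul,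
        h0, smul_zero]
  -- Either `e = ce`, whence `ef = 0` against covering, or `(1 - c)e = e`, which would make `e` act
  -- as 0 on `T`.
  rcases eq_zero_or_eq_of_mul_eq he (sub_mem (one_mem _) hC) hCi.one_sub with h1 | h1
  · refine h ?_
    rw [sub_mul, one_mul, sub_eq_zero] at h1
    rw [h1, ← Subring.mem_center_iff.1 hC, mul_assoc, ← Subring.mem_center_iff.1 hC, ← map_mul, hfc,
      map_zero, mul_zero]
  · obtain ⟨t, ht⟩ := exists_ne (0 : T)
    refine ht ?_
    rw [← hT t, ← h1, mul_smul, hT, sub_smul, one_smul, hCT, sub_self]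

theorem largestCartan_le_index_mul [Finite G] {e : MonoidAlgebra k G} (he : IsBlockIdempotent e)
    {f : MonoidAlgebra k N} (hf : IsBlockIdempotent f) (hcov : CoversBlock N e f) :
    largestCartan e ≤ N.index * largestCartan f := by
  have : IsArtinianRing (MonoidAlgebra k G) := IsArtinianRing.of_finite k _
  have : IsArtinianRing (MonoidAlgebra k N) := IsArtinianRing.of_finite k _
  have := Fintype.ofFinite (G ⧸ N)
  obtain ⟨S, _, _, T, _, _, P, _, _, π, hS, hSe, hT, hTe, hπ, s, h0, h1, hn⟩ :=
    (isGreatest_largestCartan he).1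
  have := IsSimpleModule.nontrivial (MonoidAlgebra k G) S
  have := IsSimpleModule.nontrivial (MonoidAlgebra k G) T
  let φ := MonoidAlgebra.mapDomainRingHom k N.subtype
  let _ : Module (MonoidAlgebra k N) (MonoidAlgebra k G) := Module.compHom _ φ
  let _ : Module (MonoidAlgebra k N) S := Module.compHom S φ
  let _ : Module (MonoidAlgebra k N) T := Module.compHom T φ
  let _ : Module (MonoidAlgebra k N) P := Module.compHom P φ
  have _ : IsScalarTower (MonoidAlgebra k N) (MonoidAlgebra k G) S :=
    ⟨fun a c x => mul_smul (φ a) c x⟩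
  have _ : IsScalarTower (MonoidAlgebra k N) (MonoidAlgebra k G) T :=
    ⟨fun a c x => mul_smul (φ a) c x⟩
  have _ : IsScalarTower (MonoidAlgebra k N) (MonoidAlgebra k G) P :=
    ⟨fun a c x => mul_smul (φ a) c x⟩
  obtain ⟨x, hx⟩ := hcov.exists_smul_ne_zero he hf hSe
  obtain ⟨y, hy⟩ := hcov.exists_smul_ne_zero he hf hTe
  obtain ⟨S₁, _, _, ιS, hιS, hS₁, hS₁f⟩ :=
    exists_simple_belongsToBlock hf.mem_center hf.idempotent (M := S) (x := x) hx
  obtain ⟨T₁, _, _, ιT, hιT, hT₁, hT₁f⟩ :=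
    exists_simple_belongsToBlock hf.mem_center hf.idempotent (M := T) (x := y) hy
  obtain ⟨Q, _, _, ρ, hρ⟩ := exists_isProjectiveCover (A := MonoidAlgebra k N) S₁
  obtain ⟨R, _, _, τ, hτ⟩ := exists_isProjectiveCover (A := MonoidAlgebra k N) T₁
  have := hρ.projective
  have := hτ.projective
  obtain ⟨ψ, hψ⟩ := Module.projective_lifting_property (π.restrictScalars (MonoidAlgebra k N))
    (ιS.comp ρ) hπ.surjective
  -- With `g = c.out`, the twist by `g⁻¹` makes `q ↦ g • ψ q` linear over `kN`, because `a g = g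
  -- (g⁻¹ a g)`.
  let X : G ⧸ N → Type u := fun c => Twist (conjEquiv k N c.out⁻¹) Q
  let X₁ : ∀ c, X c →ₗ[MonoidAlgebra k N] P := fun c =>
    { toFun := fun q => MonoidAlgebra.single c.out (1 : k) • ψ q
      map_add' := fun q q' => by rw [← smul_add]; exact congrArg _ (ψ.map_add q q')
      map_smul' := fun a q => by
        have h2 : ψ (conjEquiv k N c.out⁻¹ a • (show Q from q)) =
          φ (conjEquiv k N c.out⁻¹ a) • ψ q := ψ.map_smul _ _
        change MonoidAlgebra.single c.out (1 : k) • ψ (conjEquiv k N c.out⁻¹ a • (show Q from q)) =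
          φ a • MonoidAlgebra.single c.out (1 : k) • ψ q
        rw [h2, smul_smul, smul_smul, ← map_conjEquiv_mul_single, ← conjEquiv_mul, mul_inv_cancel,
          conjEquiv_one] }
  let Ψ : (Π c, X c) →ₗ[MonoidAlgebra k N] P := ∑ c, (X₁ c).comp (LinearMap.proj c)
  have hrange : ∀ (g : G) (q : Q), MonoidAlgebra.single g (1 : k) • ψ q ∈ LinearMap.range Ψ := by
    classical
    intro g q
    obtain ⟨n, hn⟩ := QuotientGroup.mk_out_eq_mul N g
    let c : G ⧸ N := QuotientGroup.mk g
    -- Here `c.out = g n`, so `g = c.out n⁻¹` and `n⁻¹` is absorbed into `q`.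
    refine ⟨Pi.single c (show X c from MonoidAlgebra.single n⁻¹ (1 : k) • q), ?_⟩
    have h2 : ∀ x : X c, Ψ (Pi.single c x) = X₁ c x := fun x => by
      simp only [Ψ, LinearMap.sum_apply, LinearMap.comp_apply, LinearMap.proj_apply]
      rw [Finset.sum_eq_single c (fun d _ hd => by rw [Pi.single_eq_of_ne hd, map_zero])
        (fun h => absurd (Finset.mem_univ _) h), Pi.single_eq_same]
    rw [h2]
    change MonoidAlgebra.single c.out (1 : k) • ψ (MonoidAlgebra.single n⁻¹ (1 : k) • q) = _
    rw [map_smul]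
    change MonoidAlgebra.single c.out (1 : k) • φ (MonoidAlgebra.single n⁻¹ (1 : k)) • ψ q = _
    rw [smul_smul]
    congr 1
    simp [φ, MonoidAlgebra.single_mul_single, c, hn]
  have hrange' : ∀ (a : MonoidAlgebra k G) (q : Q), a • ψ q ∈ LinearMap.range Ψ := by
    intro a q
    induction a using MonoidAlgebra.induction_linear with
    | zero => rw [zero_smul]; exact zero_mem _
    | add a b ha hb => rw [add_smul]; exact add_mem ha hb
    | single g c =>
      have h2 : MonoidAlgebra.single g c • ψ q = MonoidAlgebra.single g (1 : k) •
          ψ (MonoidAlgebra.single (1 : N) c • q) := by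
        rw [map_smul]
        change _ = MonoidAlgebra.single g (1 : k) • φ (MonoidAlgebra.single 1 c) • ψ q
        rw [smul_smul]
        simp [φ, MonoidAlgebra.single_mul_single]
      rw [h2]
      exact hrange _ _
  -- `ψ` has an image outside `ker π`, so the `kG`-span of its range maps onto the simple module
  -- `S`.
  have hspan : Submodule.span (MonoidAlgebra k G) (Set.range ψ) = ⊤ := by
    refine hπ.superfluous _ ?_
    have := IsSimpleModule.nontrivial (MonoidAlgebra k N) S₁
    obtain ⟨x₁, hx₁⟩ := exists_ne (0 : S₁)
    obtain ⟨q, rfl⟩ := hρ.surjective x₁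
    have hq : π (ψ q) = ιS (ρ q) := LinearMap.congr_fun hψ q
    have hq0 : π (ψ q) ≠ 0 := by
      rw [hq]
      exact fun h => hx₁ (hιS (h.trans (map_zero ιS).symm))
    refine eq_top_iff.2 fun z _ => ?_
    obtain ⟨a, ha⟩ := IsSimpleModule.toSpanSingleton_surjective (MonoidAlgebra k G) hq0 (π z)
    refine Submodule.mem_sup.2 ⟨a • ψ q, Submodule.smul_mem _ _ (Submodule.subset_span ⟨q, rfl⟩),
      z - a • ψ q, ?_, by abel⟩
    simp only [LinearMap.toSpanSingleton_apply] at ha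
    simp [ha]
  have hΨ : Function.Surjective Ψ := by
    intro z
    have hz : z ∈ Submodule.span (MonoidAlgebra k G) (Set.range ψ) := hspan.ge Submodule.mem_top
    obtain ⟨w, rfl⟩ := Finsupp.mem_span_range_iff_exists_finsupp.1 hz
    exact (LinearMap.range Ψ).sum_mem fun q _ => hrange' _ _
  have hX : ∀ c, homLength (B := MonoidAlgebra k N) R (X c) ≤ largestCartan f := by
    intro c
    have hcover := hρ.twist (conjEquiv k N c.out⁻¹)
    -- If `f` kills the conjugate of `S₁`, it kills its cover `X c` but fixes `R`, so there are no
    -- nonzero maps `R → X c`; otherwise the length is a Cartan invariant of `b`.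
    rcases smul_eq_zero_or_belongsToBlock (S := Twist (conjEquiv k N c.out⁻¹) S₁)
      hf.mem_center hf.idempotent with h2 | h2
    · have h3 := hcover.belongsToBlock (sub_mem (one_mem _) hf.mem_center)
        (fun x => by rw [sub_smul, one_smul, h2, sub_zero]) hf.idempotent.one_sub
      have h4 := hτ.belongsToBlock hf.mem_center hT₁f hf.idempotent
      rw [homLength_eq_zero]
      · exact bot_le
      · intro θ
        ext r
        rw [← h4 r, map_smul, ← h3 (θ r), smul_smul, mul_sub, mul_one, hf.idempotent.eq, sub_self,
          zero_smul, LinearMap.zero_apply]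
    · exact homLength_le_largestCartan hf h2 hT₁f hcover hτ
  have hιτ : ιT.comp τ ≠ 0 := by
    intro h
    have := IsSimpleModule.nontrivial (MonoidAlgebra k N) T₁
    obtain ⟨x₁, hx₁⟩ := exists_ne (0 : T₁)
    obtain ⟨q, rfl⟩ := hτ.surjective x₁
    exact hx₁ (hιT ((LinearMap.congr_fun h q).trans (map_zero ιT).symm))
  have key : (largestCartan e : ℕ∞) ≤ (N.index * largestCartan f : ℕ) := by
    rw [hn]
    refine (factorCount_le_homLength s h0 h1 hιτ).trans ((homLength_le_sum Ψ hΨ).trans ?_)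
    refine (Finset.sum_le_sum fun c _ => hX c).trans_eq ?_
    rw [Finset.sum_const, Finset.card_univ, ← Nat.card_eq_fintype_card, Subgroup.index]
    simp
  exact_mod_cast key

end NormalSubgroup
theorem mainTheorem10 (p : ℕ) [Fact p.Prime] (G : Type u) [Group G] [Finite G]
    (e : MonoidAlgebra (AlgebraicClosure (ZMod p)) G) (he : IsBlockIdempotent e) :
    (∀ (N : Subgroup G) [N.Normal] (r : ℕ), N.index = p ^ r →
      ∀ f : MonoidAlgebra (AlgebraicClosure (ZMod p)) N, IsBlockIdempotent f →
        CoversBlock N e f → largestCartan e ≤ p ^ r * largestCartan f) ∧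
    (∀ (Z : Subgroup G) [Z.Normal], Z ≤ Subgroup.center G → IsPGroup 2 Z →
      (p = 2 → ∃! f : MonoidAlgebra (AlgebraicClosure (ZMod p)) (G ⧸ Z),
        IsBlockIdempotent f ∧ DominatesBlock Z e f) ∧
      ∀ f : MonoidAlgebra (AlgebraicClosure (ZMod p)) (G ⧸ Z), IsBlockIdempotent f →
        DominatesBlock Z e f → largestCartan f ≤ largestCartan e) := by
  have : CharP (AlgebraicClosure (ZMod p)) p :=
    charP_of_injective_algebraMap (algebraMap (ZMod p) _).injective p
  refine ⟨fun N _ r hr f hf hcov => ?_, fun Z _ hZ h2 => ⟨fun hp => ?_, fun f hf hdom => ?_⟩⟩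
  · rw [← hr]
    exact largestCartan_le_index_mul he hf hcov
  · subst hp
    exact existsUnique_dominatesBlock 2 he hZ h2
  · have : IsArtinianRing (MonoidAlgebra (AlgebraicClosure (ZMod p)) G) :=
      IsArtinianRing.of_finite (AlgebraicClosure (ZMod p)) _
    have : IsArtinianRing (MonoidAlgebra (AlgebraicClosure (ZMod p)) (G ⧸ Z)) :=
      IsArtinianRing.of_finite (AlgebraicClosure (ZMod p)) _
    exact largestCartan_le_of_surjective _ (mapDomainRingHom_mk'_surjective Z) he hf hdom
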